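/- Let $\Omega\subset\mathbb{R}^3$ be a bounded, contractible Lipschitz domain with outward unit normal $\bm n$, and let $(\cdot,\cdot)$ and $\|\cdot\|$ be the inner product and norm of $L^2(\Omega)$. Let $H^1_0$, $H_0(\operatorname{curl})$, $H_0(\operatorname{div})$ be the spaces of $L^2$ fields with $L^2$ weak gradient, curl, divergence and with boundary conditions $v=0$, $\bm v\times\bm n=\bm 0$, $\bm v\cdot\bm n=0$ on $\partial\Omega$ respectively, and let $L^2_0=\{q\in L^2(\Omega):\int_\Omega q=0\}$. There is a constant $C>0$, depending only on $\Omega$, such that the following holds. Let $$0\to H_0^{1,h}\xrightarrow{\operatorname{grad}}H_0^h(\operatorname{curl})\xrightarrow{\operatorname{curl}}H_0^h(\operatorname{div})\xrightarrow{\operatorname{div}}L_0^{2,h}\to 0$$ be a finite-dimensional (finite element) subcomplex of the de Rham complex $0\to H_0^1\to H_0(\operatorname{curl})\to H_0(\operatorname{div})\to L_0^2\to 0$ which is exact. Let $\tau>0$, let $\bm B_0\in H_0^h(\operatorname{div})$ with $\operatorname{div}\bm B_0=0$, and let $\bm B_h\in C^1([0,\infty);H_0^h(\operatorname{div}))$ and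 $\bm E_h,\bm j_h,\bm H_h\in C^0([0,\infty);H_0^h(\operatorname{curl}))$ satisfy $\bm B_h(0)=\bm B_0$ and, for all $t\ge 0$ and all $(\bm C_h,\bm F_h,\bm K_h,\bm D_h)\in H_0^h(\operatorname{div})\times H_0^h(\operatorname{curl})^3$, $$\begin{aligned} (\partial_t\bm B_h,\bm C_h)+(\operatorname{curl}\bm E_h,\bm C_h)&=0,\\ (\bm E_h,\bm F_h)+\tau\,((\bm j_h\times\bm H_h)\times\bm H_h,\bm F_h)&=0,\\ (\bm j_h,\bm K_h)&=(\bm B_h,\operatorname{curl}\bm K_h),\\ (\bm H_h,\bm D_h)&=(\bm B_h,\bm D_h), \end{aligned}$$ where the integrals in the second equation converge (as they always do for piecewise polynomial fields). Then for every $t\ge 0$ there is $\bm A_h\in H_0^h(\operatorname{curl})$ with $\operatorname{curl}\bm A_h=\bm B_h(t)$, and the discrete helicity $\mathcal H_h:=(\bm A_h,\bm B_h(t))$ depends neither on the choice of $\bm A_h$ nor on $t$. The discrete energy $\mathcal E_h(t):=\|\bm B_h(t)\|^2$ stays in a fixed bounded interval: $$C\,|\mathcal H_h|\le\mathcal E_h(t)\le\mathcal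 E_h(0)\qquad\text{for all }t\ge 0 .$$ -/

import Mathlib

open MeasureTheory Set
open scoped ContDiff

noncomputable section

/-- Three-dimensional Euclidean space. -/
abbrev E3 : Type := EuclideanSpace ℝ (Fin 3)

/-- A bounded Lipschitz domain in `ℝ³`: a bounded connected open set which, near each of its
boundary points and in suitable Cartesian coordinates, is the set of points lying above the graph
of a Lipschitz function of two variables. -/
structure IsBoundedLipschitzDomain (Ω : Set E3) : Prop where
  isOpen : IsOpen Ω
  isConnected : IsConnected Ω
  isBounded : Bornology.IsBounded Ω
  lipschitz_boundary : ∀ p ∈ frontier Ω,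
    ∃ (e : E3 ≃ₗᵢ[ℝ] E3) (g : EuclideanSpace ℝ (Fin 2) → ℝ) (K : NNReal) (U : Set E3),
      LipschitzWith K g ∧ IsOpen U ∧ p ∈ U ∧
        ∀ y ∈ U, (y ∈ Ω ↔ g !₂[e y 0, e y 1] < e y 2)

/-! ### Classical vector calculus in `ℝ³` (applied to smooth test functions only) -/

/-- The partial derivative `∂ᵢ ψₖ` of the `k`-th component of a vector field. -/
def pderiv (i k : Fin 3) (ψ : E3 → E3) (x : E3) : ℝ :=
  (fderiv ℝ ψ x (EuclideanSpace.single i 1)) k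

/-- The classical curl. -/
def classicalCurl (ψ : E3 → E3) (x : E3) : E3 :=
  !₂[pderiv 1 2 ψ x - pderiv 2 1 ψ x,
     pderiv 2 0 ψ x - pderiv 0 2 ψ x,
     pderiv 0 1 ψ x - pderiv 1 0 ψ x]

/-- The classical divergence. -/
def classicalDiv (ψ : E3 → E3) (x : E3) : ℝ :=
  ∑ i, pderiv i i ψ x

/-- The vector product in `ℝ³`. -/
def cross (a b : E3) : E3 :=
  WithLp.toLp 2 (crossProduct (WithLp.ofLp a) (WithLp.ofLp b))

/-! ### The Hilbert spaces -/

/-- Scalar-valued `L²(Ω)`. -/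
abbrev L2S (Ω : Set E3) : Type := Lp ℝ 2 (volume.restrict Ω)

/-- Vector-valued `L²(Ω)`. -/
abbrev L2V (Ω : Set E3) : Type := Lp E3 2 (volume.restrict Ω)

/-- `g` is the weak gradient of `u` in `Ω`. -/
def IsWeakGrad (Ω : Set E3) (u : L2S Ω) (g : L2V Ω) : Prop :=
  ∀ ψ : E3 → E3, ContDiff ℝ ∞ ψ → HasCompactSupport ψ → tsupport ψ ⊆ Ω →
    ∫ x in Ω, inner ℝ (g x) (ψ x) = - ∫ x in Ω, u x * classicalDiv ψ x

/-- `w` is the weak curl of `v` in `Ω`. -/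
def IsWeakCurl (Ω : Set E3) (v w : L2V Ω) : Prop :=
  ∀ ψ : E3 → E3, ContDiff ℝ ∞ ψ → HasCompactSupport ψ → tsupport ψ ⊆ Ω →
    ∫ x in Ω, inner ℝ (w x) (ψ x) = ∫ x in Ω, inner ℝ (v x) (classicalCurl ψ x)

/-- `d` is the weak divergence of `v` in `Ω`. -/
def IsWeakDiv (Ω : Set E3) (v : L2V Ω) (d : L2S Ω) : Prop :=
  ∀ φ : E3 → ℝ, ContDiff ℝ ∞ φ → HasCompactSupport φ → tsupport φ ⊆ Ω →
    ∫ x in Ω, d x * φ x = - ∫ x in Ω, inner ℝ (v x) (gradient φ x)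

/-- `u ∈ H¹₀(Ω)` and `grad u = g`. The boundary condition `u = 0` on `∂Ω` is expressed, as usual
for traces, by the vanishing of the boundary term
`∫_∂Ω u ψ·n = ∫_Ω (grad u)·ψ + ∫_Ω u div ψ` of Green's formula, for all `ψ` smooth up to `∂Ω`. -/
def HasGrad0 (Ω : Set E3) (u : L2S Ω) (g : L2V Ω) : Prop :=
  IsWeakGrad Ω u g ∧ ∀ ψ : E3 → E3, ContDiff ℝ ∞ ψ →
    (∫ x in Ω, inner ℝ (g x) (ψ x)) + ∫ x in Ω, u x * classicalDiv ψ x = 0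

/-- `v ∈ H₀(curl)` and `curl v = w`. The boundary condition `v × n = 0` on `∂Ω` is expressed by the
vanishing of the boundary term
`-∫_∂Ω (v × n)·ψ = ∫_Ω (curl v)·ψ - ∫_Ω v·curl ψ`
of Green's formula (this is how the tangential trace on `H(curl)` is defined), for all `ψ` smooth
up to `∂Ω`. -/
def HasCurl0 (Ω : Set E3) (v w : L2V Ω) : Prop :=
  IsWeakCurl Ω v w ∧ ∀ ψ : E3 → E3, ContDiff ℝ ∞ ψ →
    (∫ x in Ω, inner ℝ (w x) (ψ x)) - ∫ x in Ω, inner ℝ (v x) (classicalCurl ψ x) = 0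

/-- `v ∈ H₀(div)` and `div v = d`. The boundary condition `v · n = 0` on `∂Ω` is expressed by the
vanishing of the boundary term
`∫_∂Ω (v·n) φ = ∫_Ω (div v) φ + ∫_Ω v·grad φ`
of Green's formula (this is how the normal trace on `H(div)` is defined), for all `φ` smooth up to
`∂Ω`. -/
def HasDiv0 (Ω : Set E3) (v : L2V Ω) (d : L2S Ω) : Prop :=
  IsWeakDiv Ω v d ∧ ∀ φ : E3 → ℝ, ContDiff ℝ ∞ φ →
    (∫ x in Ω, d x * φ x) + ∫ x in Ω, inner ℝ (v x) (gradient φ x) = 0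

/-- The weak curl is unique, so "`HasCurl0 Ω v w`" does say "`w` is *the* curl of `v`". -/
theorem HasCurl0.unique {Ω : Set E3} (hΩ : IsOpen Ω) {v w w' : L2V Ω}
    (h : HasCurl0 Ω v w) (h' : HasCurl0 Ω v w') : w = w' := by
  have key : ∀ᵐ x ∂(volume.restrict Ω), x ∈ Ω → (w - w' : L2V Ω) x = 0 := by
    refine hΩ.ae_eq_zero_of_integral_contDiff_smul_eq_zero
      (((Lp.memLp (w - w')).locallyIntegrable (by norm_num)).locallyIntegrableOn Ω) ?_
    intro φ hφ hc hs
    refine ext_inner_right ℝ fun c => ?_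
    have hψ : ContDiff ℝ ∞ (fun x => φ x • c) := hφ.smul contDiff_const
    have hψc : HasCompactSupport (fun x => φ x • c) := hc.smul_right
    have hψs : tsupport (fun x => φ x • c) ⊆ Ω :=
      (closure_mono (Function.support_smul_subset_left φ (fun _ => c))).trans hs
    have e := (h.1 _ hψ hψc hψs).trans (h'.1 _ hψ hψc hψs).symm
    have hm : MemLp (fun x => φ x • c) 2 (volume.restrict Ω) :=
      hψ.continuous.memLp_of_hasCompactSupport hψc
    have hL : ∀ z : L2V Ω, ∫ x in Ω, inner ℝ (z x) (φ x • c) = inner ℝ z (hm.toLp _) := by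
      intro z
      rw [L2.inner_def]
      refine integral_congr_ae ?_
      filter_upwards [hm.coeFn_toLp] with x hx
      rw [hx]
    have hz : inner ℝ (w - w') (hm.toLp _) = 0 := by
      rw [inner_sub_left, ← hL, ← hL, e, sub_self]
    rw [← hL] at hz
    have hint : Integrable (fun x => φ x • (w - w' : L2V Ω) x) (volume.restrict Ω) := by
      have h1 : MemLp φ 2 (volume.restrict Ω) := hφ.continuous.memLp_of_hasCompactSupport hc
      exact memLp_one_iff_integrable.1 ((Lp.memLp (w - w')).smul h1)
    rw [inner_zero_left, real_inner_comm, ← integral_inner hint, ← hz]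
    refine integral_congr_ae (Filter.Eventually.of_forall fun x => ?_)
    simp only [inner_smul_right, real_inner_comm]
  have key' : ∀ᵐ x ∂(volume.restrict Ω), (w - w' : L2V Ω) x = 0 := by
    filter_upwards [key, ae_restrict_mem hΩ.measurableSet] with x h1 h2 using h1 h2
  exact sub_eq_zero.1 ((Lp.eq_zero_iff_ae_eq_zero).2 key')

/-! ### The discrete complex and the scheme -/

/-- A finite-dimensional subcomplex
`0 → H¹₀ʰ → H₀ʰ(curl) → H₀ʰ(div) → L²₀ʰ → 0` (maps `grad`, `curl`, `div`)
of the de Rham complex with homogeneous boundary conditions, which is exact. -/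
structure DiscreteComplex (Ω : Set E3) where
  /-- the space `H¹₀ʰ` -/
  VGrad : Submodule ℝ (L2S Ω)
  /-- the space `H₀ʰ(curl)` -/
  VCurl : Submodule ℝ (L2V Ω)
  /-- the space `H₀ʰ(div)` -/
  VDiv : Submodule ℝ (L2V Ω)
  /-- the space `L²₀ʰ` -/
  VL2 : Submodule ℝ (L2S Ω)
  finite_VGrad : FiniteDimensional ℝ VGrad
  finite_VCurl : FiniteDimensional ℝ VCurl
  finite_VDiv : FiniteDimensional ℝ VDiv
  finite_VL2 : FiniteDimensional ℝ VL2
  grad_mem : ∀ u ∈ VGrad, ∃ g ∈ VCurl, HasGrad0 Ω u g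
  curl_mem : ∀ v ∈ VCurl, ∃ w ∈ VDiv, HasCurl0 Ω v w
  div_mem : ∀ v ∈ VDiv, ∃ d ∈ VL2, HasDiv0 Ω v d
  mean_zero : ∀ q ∈ VL2, ∫ x in Ω, q x = 0
  exact_VGrad : ∀ u ∈ VGrad, HasGrad0 Ω u 0 → u = 0
  exact_VCurl : ∀ v ∈ VCurl, HasCurl0 Ω v 0 → ∃ u ∈ VGrad, HasGrad0 Ω u v
  exact_VDiv : ∀ w ∈ VDiv, HasDiv0 Ω w 0 → ∃ v ∈ VCurl, HasCurl0 Ω v w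
  exact_VL2 : ∀ q ∈ VL2, ∃ w ∈ VDiv, HasDiv0 Ω w q

/-- `(B, E, j, H)` solves the structure-preserving semi-discrete scheme on `[0, ∞)` with coupling
parameter `τ` and initial value `B₀`; only the values at times `t ≥ 0` matter. In the second
equation the convergence of the integral (automatic for piecewise polynomial fields) is part of
the requirement. -/
structure IsSchemeSolution {Ω : Set E3} (X : DiscreteComplex Ω) (τ : ℝ) (B₀ : L2V Ω)
    (B E j H : ℝ → L2V Ω) : Prop where
  B_mem : ∀ t, 0 ≤ t → B t ∈ X.VDiv
  E_mem : ∀ t, 0 ≤ t → E t ∈ X.VCurl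
  j_mem : ∀ t, 0 ≤ t → j t ∈ X.VCurl
  H_mem : ∀ t, 0 ≤ t → H t ∈ X.VCurl
  B_contDiff : ContDiffOn ℝ 1 B (Ici 0)
  E_continuous : ContinuousOn E (Ici 0)
  j_continuous : ContinuousOn j (Ici 0)
  H_continuous : ContinuousOn H (Ici 0)
  initial : B 0 = B₀
  advection : ∀ t, 0 ≤ t → ∃ curlE, HasCurl0 Ω (E t) curlE ∧ ∀ C ∈ X.VDiv,
    inner ℝ (derivWithin B (Ici 0) t) C + inner ℝ curlE C = 0
  electric : ∀ t, 0 ≤ t → ∀ F ∈ X.VCurl,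
    IntegrableOn (fun x => inner ℝ (cross (cross (j t x) (H t x)) (H t x)) (F x)) Ω ∧
    inner ℝ (E t) F
      + τ * ∫ x in Ω, inner ℝ (cross (cross (j t x) (H t x)) (H t x)) (F x) = 0
  current : ∀ t, 0 ≤ t → ∀ K ∈ X.VCurl, ∀ curlK, HasCurl0 Ω K curlK →
    inner ℝ (j t) K = inner ℝ (B t) curlK
  auxiliary : ∀ t, 0 ≤ t → ∀ D ∈ X.VCurl, inner ℝ (H t) D = inner ℝ (B t) D

/-- The discrete energy `‖B‖²` (norm of `L²(Ω)`). -/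
def discreteEnergy {Ω : Set E3} (B : L2V Ω) : ℝ := ‖B‖ ^ 2

/-- `h` is the discrete helicity of `B`: there is a discrete magnetic potential `A ∈ H₀ʰ(curl)`,
`curl A = B`, and `(A, B) = h` whichever such potential is used. -/
def IsDiscreteHelicity {Ω : Set E3} (X : DiscreteComplex Ω) (B : L2V Ω) (h : ℝ) : Prop :=
  (∃ A ∈ X.VCurl, HasCurl0 Ω A B) ∧ ∀ A ∈ X.VCurl, HasCurl0 Ω A B → inner ℝ A B = h

end

/-!
Extend the fields by zero to `ℝ³` and take Fourier transforms. The boundary condition in `HasCurl0`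
says exactly that the curl of the extension is the extension of the curl, so that `B = curl A`
becomes `B̂(ξ) = 2πi ξ × Â(ξ)`, whatever the regularity of `∂Ω`. The symbol `a ↦ 2πi ξ × a` is
symmetric, hence Plancherel's identity gives Green's formula `(curl A, A') = (A, curl A')`. On the
range of the symbol its square is `(2π|ξ|)²`, hence `2π |ξ| |⟨Â, B̂⟩| ≤ |B̂|²`. This bounds the
helicity by the energy: directly on `|ξ| ≥ 1`, and on `|ξ| < 1` because `|B̂|² ≤ |Ω| ‖B‖²` and
`1 / |ξ|` is locally integrable in `ℝ³`.

In time, Faraday's law reads `∂ₜB = curl (-E)`, so `A(t) = A(0) - ∫₀ᵗ E` is a discrete potential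
of `B(t)`. Ohm's law tested with `H` gives `(B, E) = 0`, so the helicity is conserved; tested with
`j` it gives `(j, E) ≥ 0`, so the energy decreases.
-/

/-! ### Integrability, gradients and functions on the half-line -/

theorem memLp_restrict_of_continuous {V F : Type*} [PseudoMetricSpace V] [ProperSpace V]
    [MeasurableSpace V] [BorelSpace V] [NormedAddCommGroup F] [SecondCountableTopology F]
    {μ : Measure V} [IsFiniteMeasureOnCompacts μ] {s : Set V} (hb : Bornology.IsBounded s)
    (hs : MeasurableSet s) {f : V → F} (hf : Continuous f) (p : ENNReal) :
    MemLp f p (μ.restrict s) := by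
  have : IsFiniteMeasure (μ.restrict s) := ⟨by simpa using hb.measure_lt_top⟩
  obtain ⟨c, hc⟩ := hb.isCompact_closure.exists_bound_of_continuousOn hf.continuousOn
  refine MemLp.of_bound hf.aestronglyMeasurable c ?_
  filter_upwards [ae_restrict_mem hs] with x hx using hc x (subset_closure hx)

theorem integral_norm_le_sqrt_measureReal_mul_norm {α E : Type*} [MeasurableSpace α]
    {μ : Measure α} [IsFiniteMeasure μ] [NormedAddCommGroup E] (f : Lp E 2 μ) :
    ∫ x, ‖f x‖ ∂μ ≤ √(μ.real univ) * ‖f‖ := by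
  have h := eLpNorm_le_eLpNorm_mul_rpow_measure_univ one_le_two (Lp.aestronglyMeasurable f)
  rw [eLpNorm_one_eq_lintegral_enorm] at h
  rw [integral_norm_eq_lintegral_enorm (Lp.aestronglyMeasurable f), Lp.norm_def, mul_comm,
    Real.sqrt_eq_rpow, measureReal_def, ENNReal.toReal_rpow, ← ENNReal.toReal_mul]
  refine ENNReal.toReal_mono ?_ (h.trans_eq ?_)
  · exact ENNReal.mul_ne_top (Lp.eLpNorm_ne_top f) (by simp [measure_ne_top])
  · norm_num

theorem integral_inner_eq_inner_toLp {α F : Type*} [MeasurableSpace α] {μ : Measure α}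
    [NormedAddCommGroup F] [InnerProductSpace ℝ F] (v : Lp F 2 μ) {f : α → F} (hf : MemLp f 2 μ) :
    ∫ x, inner ℝ (v x) (f x) ∂μ = inner ℝ v (hf.toLp f) := by
  rw [L2.inner_def]
  refine integral_congr_ae ?_
  filter_upwards [hf.coeFn_toLp] with x hx
  rw [hx]

theorem integrableOn_ball_norm_inv {V : Type*} [NormedAddCommGroup V] [NormedSpace ℝ V]
    [FiniteDimensional ℝ V] [MeasurableSpace V] [BorelSpace V] {μ : Measure V}
    [μ.IsAddHaarMeasure] (hV : 1 < Module.finrank ℝ V) (r : ℝ) :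
    IntegrableOn (fun x : V => ‖x‖⁻¹) (Metric.ball 0 r) μ :=
  integrableOn_ball_of_norm_le_rpow (C := 1) (α := 1) hV.le (by exact_mod_cast hV)
    (ae_of_all _ fun x => by simp [Real.rpow_neg_one]) (by fun_prop)

theorem hasGradientAt_comp_inner {V : Type*} [NormedAddCommGroup V] [InnerProductSpace ℝ V]
    [CompleteSpace V] {f : ℝ → ℝ} {f' : ℝ} {ξ x : V} (hf : HasDerivAt f f' (inner ℝ x ξ)) :
    HasGradientAt (fun y => f (inner ℝ y ξ)) (f' • ξ) x := by
  have hinner : HasFDerivAt (fun y => inner ℝ y ξ) (innerSL ℝ ξ) x := by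
    simpa only [innerSL_apply_apply, real_inner_comm ξ] using! (innerSL ℝ ξ).hasFDerivAt (x := x)
  rw [hasGradientAt_iff_hasFDerivAt]
  refine (hf.comp_hasFDerivAt x hinner).congr_fderiv ?_
  ext y
  simp

section HalfLine

variable {F : Type*} [NormedAddCommGroup F] [NormedSpace ℝ F]

theorem eq_of_hasDerivWithinAt_Ici_zero {f : ℝ → F}
    (hf : ∀ t, 0 ≤ t → HasDerivWithinAt f 0 (Ici 0) t) {t : ℝ} (ht : 0 ≤ t) : f t = f 0 := by
  have hbound := (convex_Ici 0).norm_image_sub_le_of_norm_hasDerivWithin_le (f' := 0) (C := 0)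
    hf (by simp) self_mem_Ici ht
  rwa [zero_mul, norm_le_zero_iff, sub_eq_zero] at hbound

theorem exists_antiderivative_mem {K : Submodule ℝ F} [CompleteSpace K] {f : ℝ → F} {a : F}
    (hf : ContinuousOn f (Ici 0)) (hfK : ∀ t, 0 ≤ t → f t ∈ K) (ha : a ∈ K) :
    ∃ g : ℝ → F, g 0 = a ∧ ∀ t, 0 ≤ t → g t ∈ K ∧ HasDerivWithinAt g (f t) (Ici 0) t := by
  let fK : ℝ → K := fun t => ⟨f (max t 0), hfK _ (le_max_right t 0)⟩
  have hfK_cont : Continuous fK :=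
    (hf.comp_continuous (by fun_prop) fun t => le_max_right t 0).subtype_mk _
  refine ⟨fun t => ((⟨a, ha⟩ + ∫ s in (0 : ℝ)..t, fK s : K) : F), by simp,
    fun t ht => ⟨SetLike.coe_mem _, ?_⟩⟩
  have hderiv : HasDerivAt (fun t => ⟨a, ha⟩ + ∫ s in (0 : ℝ)..t, fK s) (fK t) t :=
    (hfK_cont.integral_hasStrictDerivAt 0 t).hasDerivAt.const_add _
  have hfKt : (fK t : F) = f t := congrArg f (max_eq_left ht)
  rw [← hfKt]
  exact (K.subtypeL.hasFDerivAt.comp_hasDerivAt t hderiv).hasDerivWithinAt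

end HalfLine

/-! ### Plancherel's identity for integrable square-integrable functions -/

section Plancherel

open scoped FourierTransform InnerProductSpace SchwartzMap

variable {V F : Type*} [NormedAddCommGroup V] [InnerProductSpace ℝ V] [FiniteDimensional ℝ V]
  [MeasurableSpace V] [BorelSpace V] [NormedAddCommGroup F] [InnerProductSpace ℂ F]
  [CompleteSpace F]

theorem fourier_toLp_ae_eq {f : V → F} (h₁ : Integrable f) (h₂ : MemLp f 2) :
    (𝓕 (h₂.toLp f) : Lp F 2 (volume : Measure V)) =ᵐ[volume] 𝓕 f := by
  have hcont : Continuous (𝓕 f) :=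
    VectorFourier.fourierIntegral_continuous Real.continuous_fourierChar continuous_inner h₁
  refine ae_eq_of_integral_contDiff_smul_eq
    ((Lp.memLp _).locallyIntegrable (by norm_num)) hcont.locallyIntegrable fun g hg hgc => ?_
  have hgc' : HasCompactSupport (Complex.ofRealCLM ∘ g) := hgc.comp_left rfl
  have hg' : ContDiff ℝ ∞ (Complex.ofRealCLM ∘ g) := by fun_prop
  let φ := hgc'.toSchwartzMap hg'
  calc ∫ ξ, g ξ • (𝓕 (h₂.toLp f) : Lp F 2 (volume : Measure V)) ξ
      = ((𝓕 (h₂.toLp f) : Lp F 2 (volume : Measure V)) : 𝓢'(V, F)) φ := by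
        simp [φ, Lp.toTemperedDistribution_apply]
    _ = ∫ x, (𝓕 φ) x • f x := by
        rw [← Lp.fourier_toTemperedDistribution_eq, TemperedDistribution.fourier_apply,
          Lp.toTemperedDistribution_apply]
        refine integral_congr_ae ?_
        filter_upwards [h₂.coeFn_toLp] with x hx
        rw [hx]
    _ = ∫ ξ, φ ξ • 𝓕 f ξ := by
        simpa [SchwartzMap.fourier_coe] using!
          VectorFourier.integral_fourierIntegral_smul_eq_flip (L := innerₗ V)
            Real.continuous_fourierChar continuous_inner φ.integrable h₁
    _ = ∫ ξ, g ξ • 𝓕 f ξ := by simp [φ]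

theorem memLp_fourier {f : V → F} (h₁ : Integrable f) (h₂ : MemLp f 2) : MemLp (𝓕 f) 2 :=
  (memLp_congr_ae (fourier_toLp_ae_eq h₁ h₂)).1 (Lp.memLp _)

theorem integral_inner_fourier {f g : V → F} (hf₁ : Integrable f) (hf₂ : MemLp f 2)
    (hg₁ : Integrable g) (hg₂ : MemLp g 2) :
    ∫ ξ, ⟪𝓕 f ξ, 𝓕 g ξ⟫_ℂ = ∫ x, ⟪f x, g x⟫_ℂ := by
  calc ∫ ξ, ⟪𝓕 f ξ, 𝓕 g ξ⟫_ℂ = ⟪𝓕 (hf₂.toLp f), 𝓕 (hg₂.toLp g)⟫_ℂ := by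
        rw [L2.inner_def]
        refine integral_congr_ae ?_
        filter_upwards [fourier_toLp_ae_eq hf₁ hf₂, fourier_toLp_ae_eq hg₁ hg₂] with ξ hf hg
        rw [hf, hg]
    _ = ⟪hf₂.toLp f, hg₂.toLp g⟫_ℂ := Lp.inner_fourier_eq _ _
    _ = ∫ x, ⟪f x, g x⟫_ℂ := by
        rw [L2.inner_def]
        refine integral_congr_ae ?_
        filter_upwards [hf₂.coeFn_toLp, hg₂.coeFn_toLp] with x hf hg
        rw [hf, hg]

end Plancherel

/-! ### The curl in Fourier space -/

section CurlSymbol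

open Matrix
open scoped InnerProductSpace

variable {ι : Type*} [Fintype ι]

/-- The inclusion of real vectors into complex vectors, so that the complex Fourier transform
applies to real vector fields. -/
noncomputable def complexify : EuclideanSpace ℝ ι →ₗᵢ[ℝ] EuclideanSpace ℂ ι where
  toFun a := WithLp.toLp 2 fun i => (a i : ℂ)
  map_add' a b := by ext i; simp
  map_smul' r a := by ext i; simp
  norm_map' a := by simp [EuclideanSpace.norm_eq]

@[simp]
theorem complexify_apply (a : EuclideanSpace ℝ ι) (i : ι) : complexify a i = a i := rfl

@[simp]
theorem inner_complexify (a b : EuclideanSpace ℝ ι) :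
    ⟪complexify a, complexify b⟫_ℂ = (⟪a, b⟫_ℝ : ℝ) := by
  simp [PiLp.inner_apply]

theorem eq_of_forall_inner_complexify_eq {a b : EuclideanSpace ℂ ι}
    (h : ∀ c : EuclideanSpace ℝ ι, ⟪complexify c, a⟫_ℂ = ⟪complexify c, b⟫_ℂ) : a = b := by
  classical
  ext i
  have hi : complexify (EuclideanSpace.single i 1) = EuclideanSpace.single i (1 : ℂ) := by
    ext j
    by_cases hj : j = i <;> simp [hj]
  simpa [hi, EuclideanSpace.inner_single_left] using h (EuclideanSpace.single i 1)

/-- The Fourier symbol `a ↦ 2πi ξ × a` of the curl. -/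
noncomputable def curlSymbol (ξ : E3) : EuclideanSpace ℂ (Fin 3) →ₗ[ℂ] EuclideanSpace ℂ (Fin 3) :=
  (2 * Real.pi * Complex.I) •
    ((WithLp.linearEquiv 2 ℂ (Fin 3 → ℂ)).symm.toLinearMap ∘ₗ crossProduct (complexify ξ).ofLp ∘ₗ
      (WithLp.linearEquiv 2 ℂ (Fin 3 → ℂ)).toLinearMap)

theorem curlSymbol_apply (ξ : E3) (a : EuclideanSpace ℂ (Fin 3)) : curlSymbol ξ a =
    (2 * Real.pi * Complex.I) • WithLp.toLp 2 ((complexify ξ).ofLp ⨯₃ a.ofLp) := rfl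

theorem curlSymbol_complexify (ξ c : E3) :
    curlSymbol ξ (complexify c) = (2 * Real.pi * Complex.I) • complexify (cross ξ c) := by
  rw [curlSymbol_apply]
  congr 1
  ext i
  fin_cases i <;> simp [cross, cross_apply]

theorem isSymmetric_curlSymbol (ξ : E3) : (curlSymbol ξ).IsSymmetric := by
  intro a b
  simp only [curlSymbol_apply, cross_apply, complexify_apply, PiLp.inner_apply, PiLp.smul_apply,
    smul_eq_mul, RCLike.inner_apply, map_mul, map_sub, map_ofNat, Complex.conj_ofReal,
    Complex.conj_I, Fin.sum_univ_three, cons_val]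
  ring

theorem curlSymbol_curlSymbol_curlSymbol (ξ : E3) (a : EuclideanSpace ℂ (Fin 3)) :
    curlSymbol ξ (curlSymbol ξ (curlSymbol ξ a)) =
      (((2 * Real.pi * ‖ξ‖) ^ 2 : ℝ) : ℂ) • curlSymbol ξ a := by
  have hξ : (complexify ξ).ofLp ⬝ᵥ (complexify ξ).ofLp = (‖ξ‖ : ℂ) ^ 2 := by
    rw [← Complex.ofReal_pow, EuclideanSpace.real_norm_sq_eq]
    simp [dotProduct, sq]
  have hcross : (complexify ξ).ofLp ⨯₃ ((complexify ξ).ofLp ⨯₃ ((complexify ξ).ofLp ⨯₃ a.ofLp))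
      = -(‖ξ‖ : ℂ) ^ 2 • ((complexify ξ).ofLp ⨯₃ a.ofLp) := by
    rw [cross_cross_eq_smul_sub_smul', dot_self_cross, hξ, zero_smul, zero_sub, neg_smul]
  simp only [curlSymbol_apply, map_smul, hcross, WithLp.toLp_smul, smul_smul]
  congr 1
  push_cast
  linear_combination (2 * Real.pi : ℂ) ^ 3 * ‖ξ‖ ^ 2 * (-Complex.I) * Complex.I_sq

theorem norm_curlSymbol_curlSymbol (ξ : E3) (a : EuclideanSpace ℂ (Fin 3)) :
    ‖curlSymbol ξ (curlSymbol ξ a)‖ = 2 * Real.pi * ‖ξ‖ * ‖curlSymbol ξ a‖ := by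
  rw [← sq_eq_sq₀ (norm_nonneg _) (by positivity), mul_pow, @norm_sq_eq_re_inner ℂ,
    isSymmetric_curlSymbol, curlSymbol_curlSymbol_curlSymbol, inner_smul_right,
    RCLike.re_eq_complex_re, Complex.re_ofReal_mul, ← RCLike.re_eq_complex_re,
    ← norm_sq_eq_re_inner]

theorem norm_mul_norm_inner_curlSymbol_le (ξ : E3) (a : EuclideanSpace ℂ (Fin 3)) :
    2 * Real.pi * ‖ξ‖ * ‖⟪a, curlSymbol ξ a⟫_ℂ‖ ≤ ‖curlSymbol ξ a‖ ^ 2 := by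
  obtain rfl | hξ := eq_or_ne ξ 0
  · simp
  set s := 2 * Real.pi * ‖ξ‖ with hs
  have hs0 : 0 < s := by positivity
  have hcauchySchwarz : s * (s * ‖⟪a, curlSymbol ξ a⟫_ℂ‖) ≤ s * ‖curlSymbol ξ a‖ ^ 2 :=
    calc s * (s * ‖⟪a, curlSymbol ξ a⟫_ℂ‖)
        = ‖⟪a, curlSymbol ξ (curlSymbol ξ (curlSymbol ξ a))⟫_ℂ‖ := by
          rw [curlSymbol_curlSymbol_curlSymbol, inner_smul_right, norm_mul, Complex.norm_real,
            Real.norm_of_nonneg (by positivity), ← hs]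
          ring
      _ = ‖⟪curlSymbol ξ a, curlSymbol ξ (curlSymbol ξ a)⟫_ℂ‖ := by rw [isSymmetric_curlSymbol]
      _ ≤ ‖curlSymbol ξ a‖ * ‖curlSymbol ξ (curlSymbol ξ a)‖ := norm_inner_le_norm _ _
      _ = s * ‖curlSymbol ξ a‖ ^ 2 := by rw [norm_curlSymbol_curlSymbol]; ring
  exact le_of_mul_le_mul_left hcauchySchwarz hs0

end CurlSymbol

section ZeroExtension

open scoped FourierTransform InnerProductSpace

variable {Ω : Set E3}

/-- The extension by zero to `ℝ³` of a vector field on `Ω`, with complex values so as to have a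
Fourier transform. -/
noncomputable def zeroExtension (v : L2V Ω) : E3 → EuclideanSpace ℂ (Fin 3) :=
  Ω.indicator fun x => complexify (v x)

theorem memLp_zeroExtension (hΩ : MeasurableSet Ω) (v : L2V Ω) : MemLp (zeroExtension v) 2 :=
  (memLp_indicator_iff_restrict hΩ).2
    ((complexify (ι := Fin 3)).toContinuousLinearMap.comp_memLp' (Lp.memLp v))

variable [IsFiniteMeasure (volume.restrict Ω)]

theorem integrable_zeroExtension (hΩ : MeasurableSet Ω) (v : L2V Ω) :
    Integrable (zeroExtension v) :=
  (integrable_indicator_iff hΩ).2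
    ((complexify (ι := Fin 3)).toContinuousLinearMap.integrable_comp
      ((Lp.memLp v).integrable one_le_two))

theorem integral_inner_fourier_zeroExtension (hΩ : MeasurableSet Ω) (v w : L2V Ω) :
    ∫ ξ, ⟪𝓕 (zeroExtension v) ξ, 𝓕 (zeroExtension w) ξ⟫_ℂ = (⟪v, w⟫_ℝ : ℝ) := by
  rw [integral_inner_fourier (integrable_zeroExtension hΩ v) (memLp_zeroExtension hΩ v)
    (integrable_zeroExtension hΩ w) (memLp_zeroExtension hΩ w), L2.inner_def,
    ← integral_complex_ofReal, ← integral_indicator hΩ]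
  congr 1 with x
  by_cases hx : x ∈ Ω <;> simp [zeroExtension, hx]

theorem memLp_fourier_zeroExtension (hΩ : MeasurableSet Ω) (v : L2V Ω) :
    MemLp (𝓕 (zeroExtension v)) 2 :=
  memLp_fourier (integrable_zeroExtension hΩ v) (memLp_zeroExtension hΩ v)

theorem integral_norm_sq_fourier_zeroExtension (hΩ : MeasurableSet Ω) (v : L2V Ω) :
    ∫ ξ, ‖𝓕 (zeroExtension v) ξ‖ ^ 2 = ‖v‖ ^ 2 := by
  rw [← real_inner_self_eq_norm_sq, ← Complex.ofReal_inj,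
    ← integral_inner_fourier_zeroExtension hΩ v v, ← integral_complex_ofReal]
  simp [inner_self_eq_norm_sq_to_K]

theorem norm_fourier_zeroExtension_sq_le (hΩ : MeasurableSet Ω) (v : L2V Ω) (ξ : E3) :
    ‖𝓕 (zeroExtension v) ξ‖ ^ 2 ≤ volume.real Ω * ‖v‖ ^ 2 := by
  have hL1 : ‖𝓕 (zeroExtension v) ξ‖ ≤ ∫ x in Ω, ‖v x‖ := by
    refine (VectorFourier.norm_fourierIntegral_le_integral_norm _ _ _ _ ξ).trans_eq ?_
    rw [← integral_indicator hΩ]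
    congr 1 with x
    by_cases hx : x ∈ Ω <;> simp [zeroExtension, hx]
  calc ‖𝓕 (zeroExtension v) ξ‖ ^ 2 ≤ (√(volume.real Ω) * ‖v‖) ^ 2 := by
        gcongr
        simpa using hL1.trans (integral_norm_le_sqrt_measureReal_mul_norm v)
    _ = volume.real Ω * ‖v‖ ^ 2 := by rw [mul_pow, Real.sq_sqrt measureReal_nonneg]

end ZeroExtension

section CurlFourier

open scoped FourierTransform InnerProductSpace RealInnerProductSpace

variable {Ω : Set E3}

theorem classicalCurl_smul_const {φ : E3 → ℝ} {x : E3} (hφ : DifferentiableAt ℝ φ x) (c : E3) :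
    classicalCurl (fun y => φ y • c) x = cross (gradient φ x) c := by
  have hpderiv : ∀ i k, pderiv i k (fun y => φ y • c) x = gradient φ x i * c k := by
    intro i k
    have hgrad : gradient φ x i = fderiv ℝ φ x (EuclideanSpace.single i 1) := by
      simp [← inner_gradient_left, EuclideanSpace.inner_single_right]
    rw [pderiv, fderiv_smul_const hφ, hgrad]
    simp
  ext i
  fin_cases i <;> simp [classicalCurl, cross, cross_apply, hpderiv]

theorem HasCurl0.integral_mul_inner {v w : L2V Ω} (h : HasCurl0 Ω v w) (ξ c : E3) {f f' : ℝ → ℝ}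
    (hf : ContDiff ℝ ∞ f) (hf' : ∀ s, HasDerivAt f (f' s) s) :
    ∫ x in Ω, f ⟪x, ξ⟫_ℝ * ⟪w x, c⟫_ℝ = ∫ x in Ω, f' ⟪x, ξ⟫_ℝ * ⟪v x, cross ξ c⟫_ℝ := by
  have hcurl : ∀ x, classicalCurl (fun y => f ⟪y, ξ⟫_ℝ • c) x = f' ⟪x, ξ⟫_ℝ • cross ξ c := by
    intro x
    have hgrad := hasGradientAt_comp_inner (hf' ⟪x, ξ⟫_ℝ)
    rw [classicalCurl_smul_const hgrad.differentiableAt, hgrad.gradient]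
    simp [cross]
  have hgreen := sub_eq_zero.1 (h.2 (fun x => f ⟪x, ξ⟫_ℝ • c)
    ((hf.comp (contDiff_id.inner ℝ contDiff_const)).smul contDiff_const))
  simpa only [hcurl, real_inner_smul_right] using hgreen

theorem inner_complexify_fourier_zeroExtension [IsFiniteMeasure (volume.restrict Ω)]
    (hΩ : MeasurableSet Ω) (v : L2V Ω) (ξ c : E3) :
    ⟪complexify c, 𝓕 (zeroExtension v) ξ⟫_ℂ =
      (∫ x in Ω, Real.cos (2 * Real.pi * ⟪x, ξ⟫_ℝ) * ⟪v x, c⟫_ℝ : ℝ)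
        - Complex.I * (∫ x in Ω, Real.sin (2 * Real.pi * ⟪x, ξ⟫_ℝ) * ⟪v x, c⟫_ℝ : ℝ) := by
  have hconv : Integrable fun x => Real.fourierChar (-⟪x, ξ⟫_ℝ) • zeroExtension v x :=
    (Real.fourierIntegral_convergent_iff ξ).2 (integrable_zeroExtension hΩ v)
  have hre : ∀ x, RCLike.re ⟪complexify c, Real.fourierChar (-⟪x, ξ⟫_ℝ) • zeroExtension v x⟫_ℂ =
      Ω.indicator (fun y => Real.cos (2 * Real.pi * ⟪y, ξ⟫_ℝ) * ⟪v y, c⟫_ℝ) x := by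
    intro x
    by_cases hx : x ∈ Ω <;>
      simp [zeroExtension, hx, Circle.smul_def, Real.fourierChar_apply, real_inner_comm,
        Complex.exp_re]
  have him : ∀ x, RCLike.im ⟪complexify c, Real.fourierChar (-⟪x, ξ⟫_ℝ) • zeroExtension v x⟫_ℂ =
      -Ω.indicator (fun y => Real.sin (2 * Real.pi * ⟪y, ξ⟫_ℝ) * ⟪v y, c⟫_ℝ) x := by
    intro x
    by_cases hx : x ∈ Ω <;>
      simp [zeroExtension, hx, Circle.smul_def, Real.fourierChar_apply, real_inner_comm,
        Complex.exp_im]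
  rw [Real.fourier_eq, ← integral_inner hconv, ← integral_re_add_im (hconv.const_inner _)]
  simp only [hre, him, integral_neg, integral_indicator hΩ]
  simp [sub_eq_add_neg, mul_comm]

theorem HasCurl0.fourier_zeroExtension_eq [IsFiniteMeasure (volume.restrict Ω)]
    (hΩ : MeasurableSet Ω) {v w : L2V Ω} (h : HasCurl0 Ω v w) (ξ : E3) :
    𝓕 (zeroExtension w) ξ = curlSymbol ξ (𝓕 (zeroExtension v) ξ) := by
  refine eq_of_forall_inner_complexify_eq fun c => ?_
  have hcos := h.integral_mul_inner ξ c (f := fun s => Real.cos (2 * Real.pi * s))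
    (f' := fun s => -(2 * Real.pi * Real.sin (2 * Real.pi * s))) (by fun_prop) fun s => by
      simpa [mul_comm] using ((hasDerivAt_id s).const_mul (2 * Real.pi)).cos
  have hsin := h.integral_mul_inner ξ c (f := fun s => Real.sin (2 * Real.pi * s))
    (f' := fun s => 2 * Real.pi * Real.cos (2 * Real.pi * s)) (by fun_prop) fun s => by
      simpa [mul_comm] using ((hasDerivAt_id s).const_mul (2 * Real.pi)).sin
  simp only [neg_mul, mul_assoc, integral_neg, integral_const_mul] at hcos hsin
  rw [← isSymmetric_curlSymbol, curlSymbol_complexify, inner_smul_left,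
    inner_complexify_fourier_zeroExtension hΩ, inner_complexify_fourier_zeroExtension hΩ]
  simp only [mul_assoc, hcos, hsin, map_mul, map_ofNat, Complex.conj_I, Complex.conj_ofReal]
  set S := ∫ x in Ω, Real.sin (2 * (Real.pi * ⟪x, ξ⟫_ℝ)) * ⟪v x, cross ξ c⟫_ℝ
  push_cast
  linear_combination -2 * Real.pi * S * Complex.I_sq

theorem HasCurl0.inner_comm [IsFiniteMeasure (volume.restrict Ω)]
    (hΩ : MeasurableSet Ω) {v w v' w' : L2V Ω} (h : HasCurl0 Ω v w) (h' : HasCurl0 Ω v' w') :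
    ⟪w, v'⟫_ℝ = ⟪v, w'⟫_ℝ := by
  rw [← Complex.ofReal_inj, ← integral_inner_fourier_zeroExtension hΩ,
    ← integral_inner_fourier_zeroExtension hΩ]
  congr 1 with ξ
  rw [h.fourier_zeroExtension_eq hΩ, h'.fourier_zeroExtension_eq hΩ, isSymmetric_curlSymbol]

end CurlFourier

section HelicityBound

open scoped FourierTransform InnerProductSpace

variable {Ω : Set E3} [IsFiniteMeasure (volume.restrict Ω)]

theorem HasCurl0.norm_inner_fourier_le (hΩ : MeasurableSet Ω) {v w : L2V Ω}
    (h : HasCurl0 Ω v w) (ξ : E3) :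
    ‖⟪𝓕 (zeroExtension v) ξ, 𝓕 (zeroExtension w) ξ⟫_ℂ‖ ≤
      (Metric.ball 0 1).indicator (fun η => volume.real Ω * ‖w‖ ^ 2 * ‖η‖⁻¹) ξ
        + ‖𝓕 (zeroExtension w) ξ‖ ^ 2 := by
  have hsymbol := norm_mul_norm_inner_curlSymbol_le ξ (𝓕 (zeroExtension v) ξ)
  rw [← h.fourier_zeroExtension_eq hΩ] at hsymbol
  set X := ‖⟪𝓕 (zeroExtension v) ξ, 𝓕 (zeroExtension w) ξ⟫_ℂ‖ with hX
  have hX0 : 0 ≤ X := norm_nonneg _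
  have hπ : 1 ≤ 2 * Real.pi := by linarith [Real.pi_gt_three]
  have hbound : ‖ξ‖ * X ≤ ‖𝓕 (zeroExtension w) ξ‖ ^ 2 := by
    refine le_trans ?_ hsymbol
    rw [mul_assoc]
    exact le_mul_of_one_le_left (by positivity) hπ
  by_cases hξ : ξ ∈ Metric.ball 0 1
  · rw [indicator_of_mem hξ]
    refine le_add_of_le_of_nonneg ?_ (sq_nonneg _)
    obtain rfl | hξ0 := eq_or_ne ξ 0
    · simp [hX, h.fourier_zeroExtension_eq hΩ, curlSymbol_apply]
    · rw [← div_eq_mul_inv, le_div_iff₀' (norm_pos_iff.2 hξ0)]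
      exact hbound.trans (norm_fourier_zeroExtension_sq_le hΩ w ξ)
  · rw [indicator_of_notMem hξ, zero_add]
    refine le_trans (le_mul_of_one_le_left hX0 ?_) hbound
    simpa using hξ

theorem HasCurl0.abs_inner_le (hΩ : MeasurableSet Ω) {v w : L2V Ω} (h : HasCurl0 Ω v w) :
    |⟪v, w⟫_ℝ| ≤ (volume.real Ω * (∫ ξ in Metric.ball (0 : E3) 1, ‖ξ‖⁻¹) + 1) * ‖w‖ ^ 2 := by
  have hlow : Integrable ((Metric.ball 0 1).indicator
      fun ξ : E3 => volume.real Ω * ‖w‖ ^ 2 * ‖ξ‖⁻¹) :=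
    (integrable_indicator_iff measurableSet_ball).2
      ((integrableOn_ball_norm_inv (by simp) 1).const_mul _)
  have hsq : Integrable fun ξ => ‖𝓕 (zeroExtension w) ξ‖ ^ 2 :=
    (memLp_fourier_zeroExtension hΩ w).integrable_norm_pow two_ne_zero
  calc |⟪v, w⟫_ℝ| = ‖∫ ξ, ⟪𝓕 (zeroExtension v) ξ, 𝓕 (zeroExtension w) ξ⟫_ℂ‖ := by
        rw [integral_inner_fourier_zeroExtension hΩ, Complex.norm_real, Real.norm_eq_abs]
    _ ≤ ∫ ξ, ((Metric.ball 0 1).indicator (fun η => volume.real Ω * ‖w‖ ^ 2 * ‖η‖⁻¹) ξ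
        + ‖𝓕 (zeroExtension w) ξ‖ ^ 2) :=
      norm_integral_le_of_norm_le (hlow.add hsq) (ae_of_all _ (h.norm_inner_fourier_le hΩ))
    _ = (volume.real Ω * (∫ ξ in Metric.ball (0 : E3) 1, ‖ξ‖⁻¹) + 1) * ‖w‖ ^ 2 := by
      rw [integral_add hlow hsq, integral_indicator measurableSet_ball, integral_const_mul,
        integral_norm_sq_fourier_zeroExtension hΩ]
      ring

end HelicityBound

/-! ### Integration of the weak curl in time -/

section TestFields

variable {Ω : Set E3}

theorem continuous_classicalCurl {ψ : E3 → E3} (hψ : ContDiff ℝ ∞ ψ) :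
    Continuous (classicalCurl ψ) := by
  have hpderiv : ∀ i k, Continuous (pderiv i k ψ) := fun i k =>
    (EuclideanSpace.proj (𝕜 := ℝ) k).continuous.comp
      ((hψ.continuous_fderiv (by simp)).clm_apply continuous_const)
  refine (PiLp.continuous_toLp 2 _).comp (continuous_pi fun k => ?_)
  fin_cases k
  · exact (hpderiv 1 2).sub (hpderiv 2 1)
  · exact (hpderiv 2 0).sub (hpderiv 0 2)
  · exact (hpderiv 0 1).sub (hpderiv 1 0)

theorem hasCurl0_iff (hb : Bornology.IsBounded Ω) (hΩ : MeasurableSet Ω) {v w : L2V Ω} :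
    HasCurl0 Ω v w ↔ ∀ (ψ : E3 → E3) (hψ : ContDiff ℝ ∞ ψ),
      inner ℝ w ((memLp_restrict_of_continuous hb hΩ hψ.continuous 2).toLp ψ) =
        inner ℝ v
          ((memLp_restrict_of_continuous hb hΩ (continuous_classicalCurl hψ) 2).toLp _) := by
  simp only [← integral_inner_eq_inner_toLp]
  exact ⟨fun h ψ hψ => sub_eq_zero.1 (h.2 ψ hψ),
    fun h => ⟨fun ψ hψ _ _ => h ψ hψ, fun ψ hψ => sub_eq_zero.2 (h ψ hψ)⟩⟩

theorem HasCurl0.neg (hb : Bornology.IsBounded Ω) (hΩ : MeasurableSet Ω) {v w : L2V Ω}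
    (h : HasCurl0 Ω v w) : HasCurl0 Ω (-v) (-w) :=
  (hasCurl0_iff hb hΩ).2 fun ψ hψ => by
    rw [inner_neg_left, inner_neg_left, (hasCurl0_iff hb hΩ).1 h ψ hψ]

theorem HasCurl0.of_hasDerivWithinAt (hb : Bornology.IsBounded Ω) (hΩ : MeasurableSet Ω)
    {v w v' w' : ℝ → L2V Ω} (hv : ∀ t, 0 ≤ t → HasDerivWithinAt v (v' t) (Ici 0) t)
    (hw : ∀ t, 0 ≤ t → HasDerivWithinAt w (w' t) (Ici 0) t) (h₀ : HasCurl0 Ω (v 0) (w 0))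
    (h' : ∀ t, 0 ≤ t → HasCurl0 Ω (v' t) (w' t)) {t : ℝ} (ht : 0 ≤ t) :
    HasCurl0 Ω (v t) (w t) := by
  refine (hasCurl0_iff hb hΩ).2 fun ψ hψ => sub_eq_zero.1 ?_
  set ψL : L2V Ω := (memLp_restrict_of_continuous hb hΩ hψ.continuous 2).toLp ψ with hψL
  set curlψL : L2V Ω :=
    (memLp_restrict_of_continuous hb hΩ (continuous_classicalCurl hψ) 2).toLp _ with hcurlψL
  have hconst := eq_of_hasDerivWithinAt_Ici_zero
    (f := fun t => inner ℝ (w t) ψL - inner ℝ (v t) curlψL) (fun t ht => by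
      have hd := ((hw t ht).inner ℝ (hasDerivWithinAt_const t _ ψL)).sub
        ((hv t ht).inner ℝ (hasDerivWithinAt_const t _ curlψL))
      simpa [(hasCurl0_iff hb hΩ).1 (h' t ht) ψ hψ, hψL, hcurlψL] using! hd) ht
  rw [hconst, sub_eq_zero]
  exact (hasCurl0_iff hb hΩ).1 h₀ ψ hψ

end TestFields

/-! ### The semi-discrete scheme -/

theorem inner_cross_self_right (a b : E3) : inner ℝ (cross a b) b = 0 := by
  simp [EuclideanSpace.inner_eq_star_dotProduct, cross]

theorem inner_cross_cross_left (a b : E3) :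
    inner ℝ (cross (cross a b) b) a = -‖cross a b‖ ^ 2 := by
  rw [← real_inner_self_eq_norm_sq]
  simp only [EuclideanSpace.inner_eq_star_dotProduct, cross, star_trivial]
  rw [triple_product_permutation, ← cross_anticomm a.ofLp b.ofLp, dotProduct_neg]

namespace IsSchemeSolution

variable {Ω : Set E3} {X : DiscreteComplex Ω} {τ : ℝ} {B₀ : L2V Ω} {B E j H : ℝ → L2V Ω}

theorem hasDerivWithinAt_B (h : IsSchemeSolution X τ B₀ B E j H) {t : ℝ} (ht : 0 ≤ t) :
    HasDerivWithinAt B (derivWithin B (Ici 0) t) (Ici 0) t :=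
  (h.B_contDiff.differentiableOn (by simp) t ht).hasDerivWithinAt

theorem derivWithin_B_mem (h : IsSchemeSolution X τ B₀ B E j H) (t : ℝ) :
    derivWithin B (Ici 0) t ∈ X.VDiv := by
  have := X.finite_VDiv
  have hclosure := range_derivWithin_subset_closure_span_image (𝕜 := ℝ) B (s := Ici 0)
    (t := Ici 0) (by simp) (mem_range_self t)
  refine (X.VDiv.closed_of_finiteDimensional.closure_subset_iff.2 ?_) hclosure
  exact Submodule.span_le.2 (image_subset_iff.2 h.B_mem)

theorem hasCurl0_neg_E (h : IsSchemeSolution X τ B₀ B E j H) (hΩ : IsOpen Ω)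
    (hb : Bornology.IsBounded Ω) {t : ℝ} (ht : 0 ≤ t) :
    HasCurl0 Ω (-E t) (derivWithin B (Ici 0) t) := by
  obtain ⟨curlE, hcurlE, hadvection⟩ := h.advection t ht
  obtain ⟨curlE', hmem, hcurlE'⟩ := X.curl_mem _ (h.E_mem t ht)
  rw [← hcurlE.unique hΩ hcurlE'] at hmem
  -- Since the curl of `E t` is itself discrete, Faraday's law may be tested with its own residual.
  have hresidual := hadvection _ (X.VDiv.add_mem (h.derivWithin_B_mem t) hmem)
  rw [← inner_add_left, inner_self_eq_zero] at hresidual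
  rw [eq_neg_of_add_eq_zero_left hresidual]
  exact hcurlE.neg hb hΩ.measurableSet

theorem inner_B_E (h : IsSchemeSolution X τ B₀ B E j H) {t : ℝ} (ht : 0 ≤ t) :
    inner ℝ (B t) (E t) = 0 := by
  have hohm := (h.electric t ht _ (h.H_mem t ht)).2
  simp only [inner_cross_self_right, integral_zero, mul_zero, add_zero] at hohm
  rw [← h.auxiliary t ht _ (h.E_mem t ht), real_inner_comm, hohm]

theorem inner_j_E_nonneg (h : IsSchemeSolution X τ B₀ B E j H) (hτ : 0 ≤ τ) {t : ℝ}
    (ht : 0 ≤ t) : 0 ≤ inner ℝ (j t) (E t) := by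
  have hohm := (h.electric t ht _ (h.j_mem t ht)).2
  simp only [inner_cross_cross_left, integral_neg] at hohm
  have hforce : 0 ≤ ∫ x in Ω, ‖cross (j t x) (H t x)‖ ^ 2 :=
    integral_nonneg fun x => sq_nonneg _
  rw [real_inner_comm]
  linarith [mul_nonneg hτ hforce]

theorem discreteEnergy_antitoneOn (h : IsSchemeSolution X τ B₀ B E j H) (hΩ : IsOpen Ω)
    (hb : Bornology.IsBounded Ω) (hτ : 0 ≤ τ) :
    AntitoneOn (fun t => discreteEnergy (B t)) (Ici 0) := by
  have hderiv : ∀ t ∈ Ici (0 : ℝ), HasDerivWithinAt (fun t => discreteEnergy (B t))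
      (2 * inner ℝ (B t) (derivWithin B (Ici 0) t)) (Ici 0) t :=
    fun t ht => (h.hasDerivWithinAt_B ht).norm_sq
  refine antitoneOn_of_hasDerivWithinAt_nonpos (convex_Ici 0)
    (fun t ht => (hderiv t ht).continuousWithinAt)
    (fun t ht => (hderiv t (interior_subset ht)).mono interior_subset) fun t ht => ?_
  have ht0 : 0 ≤ t := interior_subset ht
  rw [← h.current t ht0 _ (X.VCurl.neg_mem (h.E_mem t ht0)) _ (h.hasCurl0_neg_E hΩ hb ht0),
    inner_neg_right]
  linarith [h.inner_j_E_nonneg hτ ht0]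

theorem exists_potential (h : IsSchemeSolution X τ B₀ B E j H) (hΩ : IsOpen Ω)
    (hb : Bornology.IsBounded Ω) (hdiv : HasDiv0 Ω B₀ 0) :
    ∃ A : ℝ → L2V Ω, ∀ t, 0 ≤ t →
      A t ∈ X.VCurl ∧ HasCurl0 Ω (A t) (B t) ∧ HasDerivWithinAt A (-E t) (Ici 0) t := by
  have := X.finite_VCurl
  obtain ⟨A₀, hA₀, hcurlA₀⟩ := X.exact_VDiv (B 0) (h.B_mem 0 le_rfl) (h.initial ▸ hdiv)
  obtain ⟨A, rfl, hA⟩ := exists_antiderivative_mem h.E_continuous.neg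
    (fun t ht => X.VCurl.neg_mem (h.E_mem t ht)) hA₀
  exact ⟨A, fun t ht => ⟨(hA t ht).1,
    .of_hasDerivWithinAt hb hΩ.measurableSet (fun s hs => (hA s hs).2)
      (fun s hs => h.hasDerivWithinAt_B hs) hcurlA₀ (fun s hs => h.hasCurl0_neg_E hΩ hb hs) ht,
    (hA t ht).2⟩⟩

theorem inner_potential_eq (h : IsSchemeSolution X τ B₀ B E j H) (hΩ : IsOpen Ω)
    (hb : Bornology.IsBounded Ω) {A : ℝ → L2V Ω} (hcurl : ∀ t, 0 ≤ t → HasCurl0 Ω (A t) (B t))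
    (hA : ∀ t, 0 ≤ t → HasDerivWithinAt A (-E t) (Ici 0) t) {t : ℝ} (ht : 0 ≤ t) :
    inner ℝ (A t) (B t) = inner ℝ (A 0) (B 0) := by
  have : IsFiniteMeasure (volume.restrict Ω) := ⟨by simpa using hb.measure_lt_top⟩
  refine eq_of_hasDerivWithinAt_Ici_zero (f := fun t => inner ℝ (A t) (B t)) (fun s hs => ?_) ht
  refine ((hA s hs).inner ℝ (h.hasDerivWithinAt_B hs)).congr_deriv ?_
  have hgreen := (hcurl s hs).inner_comm hΩ.measurableSet (h.hasCurl0_neg_E hΩ hb hs)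
  rw [← hgreen, real_inner_comm (B s), inner_neg_right, h.inner_B_E hs]
  simp

end IsSchemeSolution

theorem corollary3p3_general {Ω : Set E3} (hΩ : IsOpen Ω) (hb : Bornology.IsBounded Ω) :
    ∃ C : ℝ, 0 < C ∧
      ∀ (X : DiscreteComplex Ω) (τ : ℝ), 0 ≤ τ →
      ∀ B₀ : L2V Ω, HasDiv0 Ω B₀ 0 →
      ∀ B E j H : ℝ → L2V Ω, IsSchemeSolution X τ B₀ B E j H →
        ∃ h : ℝ, ∀ t : ℝ, 0 ≤ t →
          IsDiscreteHelicity X (B t) h ∧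
          C * |h| ≤ discreteEnergy (B t) ∧
          discreteEnergy (B t) ≤ discreteEnergy (B 0) := by
  have : IsFiniteMeasure (volume.restrict Ω) := ⟨by simpa using hb.measure_lt_top⟩
  have hm := hΩ.measurableSet
  have hpos : 0 < volume.real Ω * (∫ ξ in Metric.ball (0 : E3) 1, ‖ξ‖⁻¹) + 1 := by positivity
  refine ⟨_, inv_pos.2 hpos, fun X τ hτ B₀ hdiv B E j H hsol => ?_⟩
  obtain ⟨A, hA⟩ := hsol.exists_potential hΩ hb hdiv
  refine ⟨inner ℝ (A 0) (B 0), fun t ht => ?_⟩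
  obtain ⟨hAmem, hcurl, -⟩ := hA t ht
  have hhelicity : inner ℝ (A t) (B t) = inner ℝ (A 0) (B 0) :=
    hsol.inner_potential_eq hΩ hb (fun s hs => (hA s hs).2.1) (fun s hs => (hA s hs).2.2) ht
  rw [← hhelicity]
  refine ⟨⟨⟨A t, hAmem, hcurl⟩, fun A' _ hA' => ?_⟩, ?_,
    hsol.discreteEnergy_antitoneOn hΩ hb hτ self_mem_Ici ht ht⟩
  · rw [← hA'.inner_comm hm hcurl, real_inner_comm]
  · exact (inv_mul_le_iff₀ hpos).2 (hcurl.abs_inner_le hm)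

/-- Boundedness of the discrete energy: with a constant `C > 0` depending only on the domain, the
discrete helicity `h` of any solution is well defined and constant in time, and the discrete energy
stays in the interval `[C |h|, energy at time 0]`. -/
theorem corollary3p3 (Ω : Set E3) (hΩ : IsBoundedLipschitzDomain Ω) (hc : ContractibleSpace Ω) :
    ∃ C : ℝ, 0 < C ∧
      ∀ (X : DiscreteComplex Ω) (τ : ℝ), 0 < τ →
      ∀ B₀ ∈ X.VDiv, HasDiv0 Ω B₀ 0 →
      ∀ B E j H : ℝ → L2V Ω, IsSchemeSolution X τ B₀ B E j H →
        ∃ h : ℝ, ∀ t : ℝ, 0 ≤ t →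
          IsDiscreteHelicity X (B t) h ∧
          C * |h| ≤ discreteEnergy (B t) ∧
          discreteEnergy (B t) ≤ discreteEnergy (B 0) := by
  obtain ⟨C, hC, hbound⟩ := corollary3p3_general hΩ.isOpen hΩ.isBounded
  exact ⟨C, hC, fun X τ hτ B₀ _ hdiv => hbound X τ hτ.le B₀ hdiv⟩
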